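/- For a map $f:\mathbb{R}^m\to\mathbb{R}^n$ (Euclidean norms), let $L(f)=\sup\{\|f(x)-f(y)\|/\|x-y\| : x\ne y\}\in[0,\infty]$ be its Lipschitz constant. For $x_0\in\mathbb{R}^m$, let $\mathrm{Lip}_{x_0}(\mathbb{R}^m,\mathbb{R}^n)$ be the vector space of all maps $f:\mathbb{R}^m\to\mathbb{R}^n$ with $L(f)<\infty$ and $f(x_0)=0$, which is a normed space with norm $L(\cdot)$. Let $\partial f(x_0)$ be Clarke's generalized Jacobian of $f$ at $x_0$, that is, the convex hull of all $n\times m$ matrices of the form $M=\lim_{k\to\infty}Jf(x_k)$, where $x_k\to x_0$, $f$ is differentiable at each $x_k$, and $Jf$ denotes the matrix of partial derivatives. Say that $\partial f(x_0)$ is of maximal rank if every $M\in\partial f(x_0)$ has rank $\min(m,n)$. **Corollary.** For all $m,n$ and all $x_0\in\mathbb{R}^m$, the set $$\{f\in \mathrm{Lip}_{x_0}(\mathbb{R}^m,\mathbb{R}^n) : \partial f(x_0)\text{ is of maximal rank}\}$$ is open in $\mathrm{Lip}_{x_0}(\mathbb{R}^m,\mathbb{R}^n)$ for the norm $L(\cdot)$.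 In particular (case $m=n$), the class of Lipschitz mappings that satisfy the hypothesis of Clarke's inverse function theorem at $x_0$ is open. -/

import Mathlib

open Filter Topology
open scoped NNReal ENNReal

namespace ClarkeOpen

/-- The Lipschitz constant `L(f) = sup {‖f x - f y‖ / ‖x - y‖ : x ≠ y} ∈ [0, ∞]` of a map
`f : ℝᵐ → ℝⁿ`, for the Euclidean norms. -/
noncomputable def lipConst {m n : ℕ}
    (f : EuclideanSpace ℝ (Fin m) → EuclideanSpace ℝ (Fin n)) : ℝ≥0∞ :=
  ⨆ (x : EuclideanSpace ℝ (Fin m)) (y : EuclideanSpace ℝ (Fin m)) (_ : x ≠ y),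
    ENNReal.ofReal (‖f x - f y‖ / ‖x - y‖)

theorem lipConst_le_iff {m n : ℕ}
    {f : EuclideanSpace ℝ (Fin m) → EuclideanSpace ℝ (Fin n)} {K : ℝ≥0} :
    lipConst f ≤ K ↔ LipschitzWith K f := by
  have key : ∀ x y : EuclideanSpace ℝ (Fin m), x ≠ y →
      (ENNReal.ofReal (‖f x - f y‖ / ‖x - y‖) ≤ K ↔ ‖f x - f y‖ ≤ K * ‖x - y‖) := by
    intro x y hxy
    have hpos : 0 < ‖x - y‖ := norm_pos_iff.2 (sub_ne_zero.2 hxy)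
    rw [ENNReal.ofReal_le_iff_le_toReal ENNReal.coe_ne_top, ENNReal.coe_toReal,
      div_le_iff₀ hpos]
  rw [lipschitzWith_iff_norm_sub_le]
  simp only [lipConst, iSup_le_iff]
  constructor
  · intro h x y
    by_cases hxy : x = y
    · simp [hxy]
    · exact (key x y hxy).1 (h x y hxy)
  · intro h x y hxy
    exact (key x y hxy).2 (h x y)

theorem lipschitzWith_lipConst {m n : ℕ}
    {f : EuclideanSpace ℝ (Fin m) → EuclideanSpace ℝ (Fin n)} (hf : lipConst f < ∞) :
    LipschitzWith (lipConst f).toNNReal f :=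
  lipConst_le_iff.1 (ENNReal.coe_toNNReal hf.ne).ge

theorem lipConst_add_le {m n : ℕ}
    {f g : EuclideanSpace ℝ (Fin m) → EuclideanSpace ℝ (Fin n)}
    (hf : lipConst f < ∞) (hg : lipConst g < ∞) :
    lipConst (f + g) ≤ lipConst f + lipConst g := by
  have h := lipConst_le_iff.2 ((lipschitzWith_lipConst hf).add (lipschitzWith_lipConst hg))
  rwa [ENNReal.coe_add, ENNReal.coe_toNNReal hf.ne, ENNReal.coe_toNNReal hg.ne] at h

theorem lipConst_smul {m n : ℕ} (c : ℝ)
    (f : EuclideanSpace ℝ (Fin m) → EuclideanSpace ℝ (Fin n)) :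
    lipConst (c • f) = ENNReal.ofReal |c| * lipConst f := by
  simp only [lipConst, ENNReal.mul_iSup]
  refine iSup_congr fun x => iSup_congr fun y => iSup_congr fun _ => ?_
  rw [← ENNReal.ofReal_mul (abs_nonneg c), Pi.smul_apply, Pi.smul_apply, ← smul_sub, norm_smul,
    Real.norm_eq_abs, mul_div_assoc]

theorem lipConst_zero {m n : ℕ} :
    lipConst (0 : EuclideanSpace ℝ (Fin m) → EuclideanSpace ℝ (Fin n)) = 0 := by
  simp [lipConst]

/-- The vector space of maps `f : ℝᵐ → ℝⁿ` with `L(f) < ∞` and `f x₀ = 0`. -/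
def lipSubmodule (m n : ℕ) (x₀ : EuclideanSpace ℝ (Fin m)) :
    Submodule ℝ (EuclideanSpace ℝ (Fin m) → EuclideanSpace ℝ (Fin n)) where
  carrier := {f | lipConst f < ∞ ∧ f x₀ = 0}
  add_mem' := by
    rintro f g ⟨hf, hf0⟩ ⟨hg, hg0⟩
    exact ⟨(lipConst_add_le hf hg).trans_lt (ENNReal.add_lt_top.2 ⟨hf, hg⟩), by simp [hf0, hg0]⟩
  zero_mem' := ⟨by simp [lipConst_zero], rfl⟩
  smul_mem' := by
    rintro c f ⟨hf, hf0⟩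
    refine ⟨?_, by simp [hf0]⟩
    rw [lipConst_smul]
    exact ENNReal.mul_lt_top ENNReal.ofReal_lt_top hf

/-- The space `Lip_{x₀}(ℝᵐ, ℝⁿ)`. It is a type of its own, so that its topology is the one of the
norm `L(·)` defined below, and not that of pointwise convergence. -/
def Lip (m n : ℕ) (x₀ : EuclideanSpace ℝ (Fin m)) : Type :=
  ↥(lipSubmodule m n x₀)

noncomputable instance (m n : ℕ) (x₀ : EuclideanSpace ℝ (Fin m)) : AddCommGroup (Lip m n x₀) :=
  inferInstanceAs (AddCommGroup ↥(lipSubmodule m n x₀))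

noncomputable instance (m n : ℕ) (x₀ : EuclideanSpace ℝ (Fin m)) : Module ℝ (Lip m n x₀) :=
  inferInstanceAs (Module ℝ ↥(lipSubmodule m n x₀))

instance (m n : ℕ) (x₀ : EuclideanSpace ℝ (Fin m)) : CoeFun (Lip m n x₀)
    (fun _ => EuclideanSpace ℝ (Fin m) → EuclideanSpace ℝ (Fin n)) :=
  ⟨fun f => f.1⟩

/-- The norm of `Lip_{x₀}(ℝᵐ, ℝⁿ)` is the Lipschitz constant. -/
noncomputable instance (m n : ℕ) (x₀ : EuclideanSpace ℝ (Fin m)) : Norm (Lip m n x₀) :=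
  ⟨fun f => (lipConst (f : EuclideanSpace ℝ (Fin m) → EuclideanSpace ℝ (Fin n))).toReal⟩

theorem Lip.norm_def {m n : ℕ} {x₀ : EuclideanSpace ℝ (Fin m)} (f : Lip m n x₀) :
    ‖f‖ = (lipConst (f : EuclideanSpace ℝ (Fin m) → EuclideanSpace ℝ (Fin n))).toReal := rfl

theorem lipCore (m n : ℕ) (x₀ : EuclideanSpace ℝ (Fin m)) :
    NormedSpace.Core ℝ (Lip m n x₀) where
  norm_nonneg f := ENNReal.toReal_nonneg
  norm_smul c f := by
    have h : lipConst (c • f : Lip m n x₀) = ENNReal.ofReal |c| * lipConst f :=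
      lipConst_smul c f.1
    rw [Lip.norm_def, h, ENNReal.toReal_mul, ENNReal.toReal_ofReal (abs_nonneg c),
      Real.norm_eq_abs, Lip.norm_def]
  norm_triangle f g := by
    have h : lipConst (f + g : Lip m n x₀) ≤ lipConst f + lipConst g :=
      lipConst_add_le f.2.1 g.2.1
    have h' := ENNReal.toReal_mono (ENNReal.add_lt_top.2 ⟨f.2.1, g.2.1⟩).ne h
    rwa [ENNReal.toReal_add f.2.1.ne g.2.1.ne] at h'
  norm_eq_zero_iff f := by
    constructor
    · intro h
      have h0 : lipConst f = 0 :=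
        (ENNReal.toReal_eq_zero_iff _).1 h |>.resolve_right f.2.1.ne
      have hL : LipschitzWith 0 f.1 := lipConst_le_iff.1 (by rw [h0]; simp)
      apply Subtype.ext
      funext x
      have hx := hL.norm_sub_le x x₀
      rw [f.2.2] at hx
      have hfx : f.1 x = 0 := by simpa using hx
      exact hfx
    · rintro rfl
      have h : lipConst (0 : Lip m n x₀) = 0 := lipConst_zero
      rw [Lip.norm_def, h, ENNReal.toReal_zero]

noncomputable instance (m n : ℕ) (x₀ : EuclideanSpace ℝ (Fin m)) :
    NormedAddCommGroup (Lip m n x₀) :=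
  NormedAddCommGroup.ofCore (lipCore m n x₀)

noncomputable instance (m n : ℕ) (x₀ : EuclideanSpace ℝ (Fin m)) :
    NormedSpace ℝ (Lip m n x₀) :=
  NormedSpace.ofCore (lipCore m n x₀)

theorem Lip.dist_def {m n : ℕ} {x₀ : EuclideanSpace ℝ (Fin m)} (f g : Lip m n x₀) :
    dist f g = (lipConst fun x => f x - g x).toReal := by
  rw [dist_eq_norm_sub]; rfl

/-- The usual `n × m` Jacobian matrix of partial derivatives `Jf(x) = (∂f_i/∂x_j (x))`. -/
noncomputable def jacobian {m n : ℕ}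
    (f : EuclideanSpace ℝ (Fin m) → EuclideanSpace ℝ (Fin n)) (x : EuclideanSpace ℝ (Fin m)) :
    Matrix (Fin n) (Fin m) ℝ :=
  Matrix.of fun i j => fderiv ℝ f x (EuclideanSpace.single j 1) i

/-- Clarke's generalized Jacobian `∂f(x₀)`: the convex hull of all limits of `Jf(x_k)`, where
`x_k → x₀` and `f` is differentiable at every `x_k`. -/
def generalizedJacobian {m n : ℕ}
    (f : EuclideanSpace ℝ (Fin m) → EuclideanSpace ℝ (Fin n)) (x₀ : EuclideanSpace ℝ (Fin m)) :
    Set (Matrix (Fin n) (Fin m) ℝ) :=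
  convexHull ℝ {M | ∃ x : ℕ → EuclideanSpace ℝ (Fin m),
    (∀ k, DifferentiableAt ℝ f (x k)) ∧ Tendsto x atTop (𝓝 x₀) ∧
      Tendsto (fun k => jacobian f (x k)) atTop (𝓝 M)}

/-- A set of `n × m` matrices is of maximal rank if each of its members has rank `min n m`. -/
def IsOfMaximalRank {m n : ℕ} (S : Set (Matrix (Fin n) (Fin m) ℝ)) : Prop :=
  ∀ M ∈ S, M.rank = min n m

end ClarkeOpen

open MeasureTheory

/-! ### Rescaled difference quotients and mollified derivatives. -/

section Rescale

variable {E : Type*} [NormedAddCommGroup E] [NormedSpace ℝ E]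

/-! If `L(g - f) ≤ ε`, then `∂g(x₀)` lies in the closed `2ε`-neighbourhood of `∂f(x₀)`. Since
`∂f(x₀)` is compact and maximal rank is an open condition, a small such neighbourhood still consists
of matrices of maximal rank. The obstacle is that `g` may be differentiable where `f` is not, so
`Jg` and `Jf` cannot be compared pointwise. They can be compared almost everywhere, by Rademacher's
theorem, and this suffices: `jacobian_mem_of_ae` shows that a Jacobian at any point of
differentiability belongs to every closed convex set that contains almost all nearby Jacobians. -/

theorem LipschitzWith.rescale {u : E → ℝ} {C : ℝ≥0} (hu : LipschitzWith C u) (x : E) {r : ℝ}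
    (hr : r ≠ 0) : LipschitzWith C fun z => r⁻¹ * (u (x + r • z) - u x) := by
  rw [lipschitzWith_iff_norm_sub_le]
  intro y z
  have h := hu.norm_sub_le (x + r • y) (x + r • z)
  rw [add_sub_add_left_eq_sub, ← smul_sub, norm_smul] at h
  rw [← mul_sub, sub_sub_sub_cancel_right, norm_mul, norm_inv,
    inv_mul_le_iff₀ (norm_pos_iff.2 hr)]
  linarith

theorem lineDeriv_rescale (u : E → ℝ) (x : E) {r : ℝ} (hr : r ≠ 0) (z v : E) :
    lineDeriv ℝ (fun z => r⁻¹ * (u (x + r • z) - u x)) z v = lineDeriv ℝ u (x + r • z) v := by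
  have h := deriv_comp_mul_left r (fun t : ℝ => u (x + r • z + t • v)) 0
  rw [mul_zero, smul_eq_mul] at h
  simp only [lineDeriv]
  rw [deriv_const_mul_field, deriv_sub_const]
  simp only [smul_add, smul_smul, ← add_assoc] at h ⊢
  rw [h, inv_mul_cancel_left₀ hr]

variable [MeasurableSpace E] [BorelSpace E] {μ : Measure E}

theorem integrable_lineDeriv_comp_smul_mul {u : E → ℝ} {C : ℝ≥0} (hu : LipschitzWith C u) (x : E)
    {r : ℝ} (hr : r ≠ 0) (v : E) {φ : E → ℝ} (hφ : Integrable φ μ) :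
    Integrable (fun z => lineDeriv ℝ u (x + r • z) v * φ z) μ := by
  have h := (hu.rescale x hr).memLp_lineDeriv (μ := μ) v
  simp only [lineDeriv_rescale u x hr] at h
  exact hφ.mul_of_top_right h

variable [FiniteDimensional ℝ E] [μ.IsAddHaarMeasure]

/-- Mollified directional derivatives of a Lipschitz function converge to the derivative at every
point of differentiability. -/
theorem tendsto_integral_lineDeriv_comp_smul_mul {u : E → ℝ} {C : ℝ≥0} (hu : LipschitzWith C u)
    {x : E} (hx : DifferentiableAt ℝ u x) (v : E) {φ : E → ℝ} (hφ : ContDiff ℝ 1 φ)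
    (hφc : HasCompactSupport φ) :
    Tendsto (fun r : ℝ => ∫ z, lineDeriv ℝ u (x + r • z) v * φ z ∂μ) (𝓝[≠] 0)
      (𝓝 (fderiv ℝ u x v * ∫ z, φ z ∂μ)) := by
  obtain ⟨D, hD⟩ := hφ.lipschitzWith_of_hasCompactSupport hφc one_ne_zero
  -- The claimed limit is itself an integration by parts, applied to the linear map `Du(x)`.
  have hlin : ∫ z, lineDeriv ℝ φ z (-v) * fderiv ℝ u x z ∂μ
      = fderiv ℝ u x v * ∫ z, φ z ∂μ := by
    rw [← LipschitzWith.integral_lineDeriv_mul_eq (fderiv ℝ u x).lipschitz hD hφc, ← integral_const_mul]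
    congr with z
    rw [(fderiv ℝ u x).differentiableAt.lineDeriv_eq_fderiv, ContinuousLinearMap.fderiv]
  -- Moving the derivative onto `φ` leaves a difference quotient of `u` at `x`, which tends to
  -- `Du(x) z` and is dominated by `C * ‖z‖`.
  have hparts : ∀ r : ℝ, r ≠ 0 → ∫ z, lineDeriv ℝ u (x + r • z) v * φ z ∂μ
      = ∫ z, lineDeriv ℝ φ z (-v) * (r⁻¹ * (u (x + r • z) - u x)) ∂μ := by
    intro r hr
    rw [← LipschitzWith.integral_lineDeriv_mul_eq (hu.rescale x hr) hD hφc]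
    simp only [lineDeriv_rescale u x hr]
  have hφ' : ∀ z, lineDeriv ℝ φ z (-v) = fderiv ℝ φ z (-v) := fun z =>
    (hφ.differentiable one_ne_zero z).lineDeriv_eq_fderiv
  simp only [hφ'] at hlin hparts
  have hcont : Continuous fun z => fderiv ℝ φ z (-v) :=
    (hφ.continuous_fderiv one_ne_zero).clm_apply continuous_const
  have hsupp : HasCompactSupport fun z => fderiv ℝ φ z (-v) := hφc.fderiv_apply ℝ (-v)
  rw [← hlin]
  refine Tendsto.congr' (eventually_mem_nhdsWithin.mono fun r hr => (hparts r hr).symm) ?_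
  refine tendsto_integral_filter_of_dominated_convergence
    (fun z => ‖fderiv ℝ φ z (-v)‖ * (C * ‖z‖)) ?_ ?_ ?_ ?_
  · refine eventually_mem_nhdsWithin.mono fun r hr => ?_
    exact (hcont.mul (hu.rescale x hr).continuous).aestronglyMeasurable
  · refine eventually_mem_nhdsWithin.mono fun r hr => .of_forall fun z => ?_
    rw [norm_mul]
    have := (hu.rescale x hr).norm_sub_le z 0
    simp only [smul_zero, add_zero, sub_self, mul_zero, sub_zero] at this
    gcongr
  · exact (hcont.norm.mul (continuous_const.mul continuous_norm)).integrable_of_hasCompactSupport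
      hsupp.norm.mul_right
  · refine .of_forall fun z => Tendsto.const_mul _ ?_
    have h := (hx.hasFDerivAt.hasLineDerivAt z).tendsto_slope_zero
    simpa using h

end Rescale

/-! ### Compactness of convex hulls in finite dimension. -/

section ConvexHull

/-- By Carathéodory, at most `dim V + 1` points are needed, so the hull is a finite union of
continuous images of the compact sets simplex × `sᵏ`. -/
theorem IsCompact.convexHull_of_finiteDimensional {V : Type*} [AddCommGroup V] [Module ℝ V]
    [TopologicalSpace V] [IsTopologicalAddGroup V] [ContinuousSMul ℝ V] [FiniteDimensional ℝ V]
    {s : Set V} (hs : IsCompact s) : IsCompact (convexHull ℝ s) := by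
  let F : (k : ℕ) → (Fin k → ℝ) × (Fin k → V) → V := fun k p => ∑ i, p.1 i • p.2 i
  have hF : ∀ k, Continuous (F k) := fun k => by fun_prop
  have heq : convexHull ℝ s = ⋃ k ∈ Set.Iic (Module.finrank ℝ V + 1),
      F k '' (stdSimplex ℝ (Fin k) ×ˢ Set.univ.pi fun _ => s) := by
    refine Set.Subset.antisymm (fun x hx => ?_) ?_
    · obtain ⟨ι, _, z, w, hz, hind, hw, hw1, rfl⟩ := eq_pos_convex_span_of_mem_convexHull hx
      have e := Fintype.equivFin ι
      refine Set.mem_biUnion (x := Fintype.card ι) ?_ ⟨(w ∘ e.symm, z ∘ e.symm), ⟨⟨?_, ?_⟩, ?_⟩, ?_⟩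
      · exact hind.card_le_finrank_succ.trans (Nat.succ_le_succ (Submodule.finrank_le _))
      · exact fun i => (hw _).le
      · exact (Equiv.sum_comp e.symm w).trans hw1
      · exact fun i _ => hz ⟨_, rfl⟩
      · exact Equiv.sum_comp e.symm fun i => w i • z i
    · refine Set.iUnion₂_subset fun k _ => ?_
      rintro _ ⟨⟨w, z⟩, ⟨hw, hz⟩, rfl⟩
      exact (convex_convexHull ℝ s).sum_mem (fun i _ => hw.1 i) hw.2
        fun i _ => subset_convexHull ℝ s (hz i trivial)
  rw [heq]
  exact (Set.finite_Iic _).isCompact_biUnion fun k _ =>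
    ((isCompact_stdSimplex ℝ (Fin k)).prod (isCompact_univ_pi fun _ => hs)).image (hF k)

end ConvexHull

open scoped Matrix.Norms.Elementwise

/-- Rank is lower semicontinuous, and `min n m` is its largest possible value, so equality amounts
to `≥`. -/
theorem Matrix.isOpen_setOf_rank_eq_min (m n : ℕ) :
    IsOpen {M : Matrix (Fin n) (Fin m) ℝ | M.rank = min n m} := by
  let T : Matrix (Fin n) (Fin m) ℝ →ₗ[ℝ] ((Fin m → ℝ) →L[ℝ] (Fin n → ℝ)) :=
    LinearMap.toContinuousLinearMap.toLinearMap ∘ₗ Matrix.mulVecBilin ℝ ℝ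
  have hT : Continuous T := T.continuous_of_finiteDimensional
  convert (isOpen_setOfPred_nat_le_rank (min n m)).preimage hT using 1
  ext M
  have h : ((T M : (Fin m → ℝ) →L[ℝ] (Fin n → ℝ)) : (Fin m → ℝ) →ₗ[ℝ] (Fin n → ℝ)).rank
      = (M.rank : Cardinal) := (Module.finrank_eq_rank ℝ _).symm
  have hle : M.rank ≤ min n m := le_min M.rank_le_height M.rank_le_width
  simp only [Set.mem_ofPred_eq, Set.mem_preimage, h, Nat.cast_le]
  exact ⟨fun h => h.ge, fun h => hle.antisymm h⟩

/-! ### Stability of the generalized Jacobian. -/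

namespace ClarkeOpen

variable {m n : ℕ} {f g : EuclideanSpace ℝ (Fin m) → EuclideanSpace ℝ (Fin n)} {C : ℝ≥0}
  {x₀ x : EuclideanSpace ℝ (Fin m)}

theorem jacobian_apply (f : EuclideanSpace ℝ (Fin m) → EuclideanSpace ℝ (Fin n))
    (x : EuclideanSpace ℝ (Fin m)) (i : Fin n) (j : Fin m) :
    jacobian f x i j = fderiv ℝ f x (EuclideanSpace.single j 1) i := rfl

theorem norm_jacobian_le (hf : LipschitzWith C f) (x : EuclideanSpace ℝ (Fin m)) :
    ‖jacobian f x‖ ≤ C := by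
  refine (Matrix.norm_le_iff C.2).2 fun i j => ?_
  calc ‖jacobian f x i j‖ ≤ ‖fderiv ℝ f x (EuclideanSpace.single j 1)‖ := PiLp.norm_apply_le _ i
    _ ≤ ‖fderiv ℝ f x‖ * ‖EuclideanSpace.single j (1 : ℝ)‖ := ContinuousLinearMap.le_opNorm _ _
    _ ≤ C := by simpa using norm_fderiv_le_of_lipschitz ℝ hf

theorem jacobian_sub (hf : DifferentiableAt ℝ f x) (hg : DifferentiableAt ℝ g x) :
    jacobian (fun y => f y - g y) x = jacobian f x - jacobian g x := by
  ext i j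
  simp [jacobian_apply, fderiv_fun_sub hf hg]

theorem _root_.DifferentiableAt.euclidean_coord (hf : DifferentiableAt ℝ f x) (i : Fin n) :
    DifferentiableAt ℝ (fun y => f y i) x :=
  (EuclideanSpace.proj (𝕜 := ℝ) i).differentiableAt.comp x hf

theorem jacobian_eq_fderiv_coord (hf : DifferentiableAt ℝ f x) (i : Fin n) (j : Fin m) :
    jacobian f x i j = fderiv ℝ (fun y => f y i) x (EuclideanSpace.single j 1) := by
  have h := ((EuclideanSpace.proj (𝕜 := ℝ) i).hasFDerivAt.comp x hf.hasFDerivAt).fderiv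
  exact (DFunLike.congr_fun h (EuclideanSpace.single j 1)).symm

theorem jacobian_eq_lineDeriv (hf : DifferentiableAt ℝ f x) (i : Fin n) (j : Fin m) :
    jacobian f x i j = lineDeriv ℝ (fun y => f y i) x (EuclideanSpace.single j 1) := by
  rw [(hf.euclidean_coord i).lineDeriv_eq_fderiv, jacobian_eq_fderiv_coord hf]

theorem _root_.LipschitzWith.euclidean_coord (hf : LipschitzWith C f) (i : Fin n) :
    LipschitzWith C fun y => f y i := by
  rw [lipschitzWith_iff_norm_sub_le]
  exact fun y z => (PiLp.norm_apply_le (f y - f z) i).trans (hf.norm_sub_le y z)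

theorem _root_.Matrix.dual_apply_eq_sum (ℓ : StrongDual ℝ (Matrix (Fin n) (Fin m) ℝ))
    (M : Matrix (Fin n) (Fin m) ℝ) :
    ℓ M = ∑ i, ∑ j, M i j * ℓ (Matrix.single i j 1) := by
  conv_lhs => rw [Matrix.matrix_eq_sum_single M]
  simp only [map_sum]
  refine Finset.sum_congr rfl fun i _ => Finset.sum_congr rfl fun j _ => ?_
  rw [← smul_eq_mul, ← map_smul, Matrix.smul_single, smul_eq_mul, mul_one]

/-- The Jacobian at any point of differentiability is controlled by its values almost everywhere
nearby. -/
theorem jacobian_mem_of_ae (hf : LipschitzWith C f) (hx : DifferentiableAt ℝ f x)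
    {K : Set (Matrix (Fin n) (Fin m) ℝ)} (hK : Convex ℝ K) (hKc : IsClosed K)
    {s : Set (EuclideanSpace ℝ (Fin m))} (hs : s ∈ 𝓝 x)
    (h : ∀ᵐ y, y ∈ s → jacobian f y ∈ K) : jacobian f x ∈ K := by
  have : LocallyConvexSpace ℝ (Matrix (Fin n) (Fin m) ℝ) :=
    inferInstanceAs (LocallyConvexSpace ℝ (Fin n → Fin m → ℝ))
  by_contra hxK
  -- Separate `Jf(x)` from `K`: averages of `ℓ (Jf)` against a probability density shrinking to `x`
  -- are at least `c`, yet tend to `ℓ (Jf(x)) < c`.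
  obtain ⟨ℓ, c, hlt, hc⟩ := geometric_hahn_banach_point_closed hK hKc hxK
  let b : ContDiffBump (0 : EuclideanSpace ℝ (Fin m)) := default
  let φ := b.normed volume
  have hφ1 : ∫ z, φ z = 1 := b.integral_normed
  have hφint : Integrable φ := b.integrable_normed
  have hlim : Tendsto (fun r : ℝ => ∑ i, ∑ j, (∫ z, lineDeriv ℝ (fun y => f y i) (x + r • z)
      (EuclideanSpace.single j 1) * φ z) * ℓ (Matrix.single i j 1)) (𝓝[≠] 0)
      (𝓝 (ℓ (jacobian f x))) := by
    rw [Matrix.dual_apply_eq_sum]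
    refine tendsto_finsetSum _ fun i _ => tendsto_finsetSum _ fun j _ => Tendsto.mul_const _ ?_
    rw [jacobian_eq_fderiv_coord hx]
    have := tendsto_integral_lineDeriv_comp_smul_mul (μ := volume) (hf.euclidean_coord i)
      (hx.euclidean_coord i) (EuclideanSpace.single j 1) (φ := φ) b.contDiff_normed
      b.hasCompactSupport_normed
    rwa [hφ1, mul_one] at this
  refine hlt.not_ge (ge_of_tendsto hlim ?_)
  obtain ⟨δ, hδ, hδs⟩ := Metric.mem_nhds_iff.1 hs
  have hsmall : ∀ᶠ r : ℝ in 𝓝[≠] 0, |r| * b.rOut < δ := by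
    have : Tendsto (fun r : ℝ => |r| * b.rOut) (𝓝 0) (𝓝 (|0| * b.rOut)) :=
      (continuous_abs.mul continuous_const).tendsto 0
    rw [abs_zero, zero_mul] at this
    exact nhdsWithin_le_nhds (this.eventually (gt_mem_nhds hδ))
  filter_upwards [hsmall, eventually_mem_nhdsWithin] with r hr hr0
  have hI : ∀ i j, Integrable fun z => lineDeriv ℝ (fun y => f y i) (x + r • z)
      (EuclideanSpace.single j 1) * φ z * ℓ (Matrix.single i j 1) := fun i j =>
    (integrable_lineDeriv_comp_smul_mul (hf.euclidean_coord i) x hr0 _ hφint).mul_const _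
  have hsum : ∑ i, ∑ j, (∫ z, lineDeriv ℝ (fun y => f y i) (x + r • z)
      (EuclideanSpace.single j 1) * φ z) * ℓ (Matrix.single i j 1)
      = ∫ z, ∑ i, ∑ j, lineDeriv ℝ (fun y => f y i) (x + r • z)
        (EuclideanSpace.single j 1) * φ z * ℓ (Matrix.single i j 1) := by
    rw [integral_finsetSum _ fun i _ => integrable_finsetSum _ fun j _ => hI i j]
    refine Finset.sum_congr rfl fun i _ => ?_
    rw [integral_finsetSum _ fun j _ => hI i j]
    simp only [integral_mul_const]
  -- Needed to pull the almost-everywhere statements in `y` back along `y = x + r • z`.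
  have hqmp : Measure.QuasiMeasurePreserving
      (fun z : EuclideanSpace ℝ (Fin m) => x + r • z) volume volume :=
    (measurePreserving_add_left volume x).quasiMeasurePreserving.comp
      (Measure.quasiMeasurePreserving_smul volume hr0)
  rw [hsum]
  calc c = ∫ z, c * φ z := by rw [integral_const_mul, hφ1, mul_one]
    _ ≤ _ := by
      refine integral_mono_ae (hφint.const_mul c)
        (integrable_finsetSum _ fun i _ => integrable_finsetSum _ fun j _ => hI i j) ?_
      filter_upwards [hqmp.ae h, hqmp.ae hf.ae_differentiableAt] with z hz hdz
      have heq : ∑ i, ∑ j, lineDeriv ℝ (fun y => f y i) (x + r • z)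
          (EuclideanSpace.single j 1) * φ z * ℓ (Matrix.single i j 1)
          = ℓ (jacobian f (x + r • z)) * φ z := by
        rw [Matrix.dual_apply_eq_sum, Finset.sum_mul]
        refine Finset.sum_congr rfl fun i _ => ?_
        rw [Finset.sum_mul]
        refine Finset.sum_congr rfl fun j _ => ?_
        rw [jacobian_eq_lineDeriv hdz]
        ring
      rw [heq]
      by_cases hφz : φ z = 0
      · simp [hφz]
      · have hzs : z ∈ Metric.ball 0 b.rOut := by
          rw [← b.support_normed_eq (μ := volume)]
          exact hφz
        rw [mem_ball_zero_iff] at hzs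
        refine mul_le_mul_of_nonneg_right (hc _ (hz (hδs ?_))).le (b.nonneg_normed z)
        rw [Metric.mem_ball, dist_self_add_left, norm_smul, Real.norm_eq_abs]
        exact (mul_le_mul_of_nonneg_left hzs.le (abs_nonneg r)).trans_lt hr

/-- The limits of Jacobians of `f` at points of differentiability tending to `x₀`. -/
def limitingJacobian (f : EuclideanSpace ℝ (Fin m) → EuclideanSpace ℝ (Fin n))
    (x₀ : EuclideanSpace ℝ (Fin m)) : Set (Matrix (Fin n) (Fin m) ℝ) :=
  {M | MapClusterPt M (𝓝[{x | DifferentiableAt ℝ f x}] x₀) (jacobian f)}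

theorem mem_limitingJacobian_iff {M : Matrix (Fin n) (Fin m) ℝ} :
    M ∈ limitingJacobian f x₀ ↔ ∃ x : ℕ → EuclideanSpace ℝ (Fin m),
      (∀ k, DifferentiableAt ℝ f (x k)) ∧ Tendsto x atTop (𝓝 x₀) ∧
        Tendsto (fun k => jacobian f (x k)) atTop (𝓝 M) := by
  constructor
  · intro h
    have : FirstCountableTopology (Matrix (Fin n) (Fin m) ℝ) :=
      inferInstanceAs (FirstCountableTopology (Fin n → Fin m → ℝ))
    have hne : NeBot (comap (jacobian f) (𝓝 M) ⊓ 𝓝[{x | DifferentiableAt ℝ f x}] x₀) := by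
      rw [← map_neBot_iff (jacobian f), Filter.push_pull']
      exact h
    obtain ⟨x, hx⟩ := exists_seq_tendsto
      (comap (jacobian f) (𝓝 M) ⊓ 𝓝[{x | DifferentiableAt ℝ f x}] x₀)
    rw [tendsto_inf, tendsto_comap_iff, tendsto_nhdsWithin_iff] at hx
    obtain ⟨hxM, hx0, hxd⟩ := hx
    obtain ⟨N, hN⟩ := eventually_atTop.1 hxd
    exact ⟨fun k => x (k + N), fun k => hN _ (Nat.le_add_left N k),
      hx0.comp (tendsto_add_atTop_nat N), hxM.comp (tendsto_add_atTop_nat N)⟩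
  · rintro ⟨x, hxd, hx0, hxM⟩
    exact hxM.mapClusterPt.of_comp (tendsto_nhdsWithin_iff.2 ⟨hx0, .of_forall hxd⟩)

theorem generalizedJacobian_eq_convexHull :
    generalizedJacobian f x₀ = convexHull ℝ (limitingJacobian f x₀) := by
  rw [generalizedJacobian]
  congr 1
  ext M
  exact mem_limitingJacobian_iff.symm

theorem isCompact_limitingJacobian (hf : LipschitzWith C f) :
    IsCompact (limitingJacobian f x₀) := by
  refine (isCompact_closedBall (0 : Matrix (Fin n) (Fin m) ℝ) C).of_isClosed_subset
    isClosed_setOfPred_clusterPt fun M hM => ?_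
  obtain ⟨x, -, -, hx⟩ := mem_limitingJacobian_iff.1 hM
  rw [mem_closedBall_zero_iff]
  exact le_of_tendsto hx.norm (.of_forall fun k => norm_jacobian_le hf _)

theorem isCompact_generalizedJacobian (hf : LipschitzWith C f) :
    IsCompact (generalizedJacobian f x₀) := by
  rw [generalizedJacobian_eq_convexHull]
  exact (isCompact_limitingJacobian hf).convexHull_of_finiteDimensional

/-- Upper semicontinuity: Jacobians are bounded, so values outside `U` arbitrarily near `x₀` would
cluster at a limiting Jacobian outside `U`. -/
theorem eventually_jacobian_mem (hf : LipschitzWith C f) {U : Set (Matrix (Fin n) (Fin m) ℝ)}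
    (hU : IsOpen U) (h : generalizedJacobian f x₀ ⊆ U) :
    ∀ᶠ x in 𝓝 x₀, DifferentiableAt ℝ f x → jacobian f x ∈ U := by
  suffices H : ∀ᶠ x in 𝓝[{x | DifferentiableAt ℝ f x}] x₀, jacobian f x ∈ U from
    eventually_nhdsWithin_iff.1 H
  by_contra hcon
  obtain ⟨M, ⟨-, hMU⟩, hM⟩ := ((isCompact_closedBall (0 : Matrix (Fin n) (Fin m) ℝ) C).inter_right
    hU.isClosed_compl).exists_mapClusterPt_of_frequently (f := jacobian f)
    ((not_eventually.1 hcon).mono fun x hx =>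
      ⟨mem_closedBall_zero_iff.2 (norm_jacobian_le hf x), hx⟩)
  rw [generalizedJacobian_eq_convexHull] at h
  exact hMU (h (subset_convexHull ℝ _ hM))

/-- Clarke's generalized Jacobian is stable under perturbations that are small for the Lipschitz
constant. -/
theorem generalizedJacobian_subset_cthickening {ε : ℝ≥0} (hε : 0 < ε) (hf : LipschitzWith C f)
    (hfg : LipschitzWith ε fun x => g x - f x) :
    generalizedJacobian g x₀ ⊆ Metric.cthickening (2 * ε) (generalizedJacobian f x₀) := by
  -- One `ε` pays for the distance of `Jf(y)` to `∂f(x₀)`, the other for that of `Jg(y)` to `Jf(y)`.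
  set K := Metric.cthickening (2 * ε : ℝ) (generalizedJacobian f x₀) with hKdef
  have hK : Convex ℝ K := (convex_convexHull ℝ _).cthickening _
  have hKc : IsClosed K := Metric.isClosed_cthickening
  have hg : LipschitzWith (ε + C) g := by simpa using hfg.add hf
  have hev : ∀ᶠ x in 𝓝 x₀, DifferentiableAt ℝ f x →
      jacobian f x ∈ Metric.thickening ε (generalizedJacobian f x₀) :=
    eventually_jacobian_mem hf Metric.isOpen_thickening
      (Metric.self_subset_thickening (NNReal.coe_pos.2 hε) _)
  have hmem : ∀ᶠ x in 𝓝 x₀, DifferentiableAt ℝ g x → jacobian g x ∈ K := by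
    -- The bound on `Jf` is needed on a whole neighbourhood of `x`, as `f` may fail to be
    -- differentiable at `x` itself.
    filter_upwards [hev.eventually_nhds] with x hx hgx
    refine jacobian_mem_of_ae hg hgx hK hKc hx ?_
    filter_upwards [hf.ae_differentiableAt, hg.ae_differentiableAt] with y hfy hgy hy
    have hle : dist (jacobian g y) (jacobian f y) ≤ ε := by
      rw [dist_eq_norm_sub, ← jacobian_sub hgy hfy]
      exact norm_jacobian_le hfg y
    obtain ⟨M, hM, hlt⟩ := Metric.mem_thickening_iff.1 (hy hfy)
    refine Metric.mem_cthickening_of_dist_le _ M _ _ hM ?_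
    linarith [dist_triangle (jacobian g y) (jacobian f y) M]
  refine convexHull_min ?_ hK
  rintro M ⟨x, hxd, hx0, hxM⟩
  exact hKc.mem_of_tendsto hxM ((hx0.eventually hmem).mono fun k hk => hk (hxd k))

end ClarkeOpen

theorem mainTheorem4 (m n : ℕ) (x₀ : EuclideanSpace ℝ (Fin m)) :
    IsOpen {f : ClarkeOpen.Lip m n x₀ |
      ClarkeOpen.IsOfMaximalRank (ClarkeOpen.generalizedJacobian f x₀)} := by
  rw [Metric.isOpen_iff]
  intro f hf
  have hfL := ClarkeOpen.lipschitzWith_lipConst f.2.1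
  obtain ⟨δ, hδ, hsub⟩ :=
    (ClarkeOpen.isCompact_generalizedJacobian hfL (x₀ := x₀)).exists_cthickening_subset_open
      (Matrix.isOpen_setOf_rank_eq_min m n) hf
  -- The radius `δ / 2` compensates the factor `2` in the thickening.
  refine ⟨δ / 2, half_pos hδ, fun g hg M hM => hsub ?_⟩
  have hgf : ClarkeOpen.lipConst (fun x => g.1 x - f.1 x) < ∞ := (g - f).2.1
  have hlip : LipschitzWith (δ / 2).toNNReal fun x => g.1 x - f.1 x := by
    rw [Metric.mem_ball, ClarkeOpen.Lip.dist_def] at hg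
    exact (ClarkeOpen.lipschitzWith_lipConst hgf).weaken (NNReal.le_toNNReal_of_coe_le hg.le)
  have h := ClarkeOpen.generalizedJacobian_subset_cthickening
    (Real.toNNReal_pos.2 (half_pos hδ)) hfL hlip hM
  rwa [Real.coe_toNNReal _ (half_pos hδ).le, mul_div_cancel₀ δ two_ne_zero] at h
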